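/- Let $\mathbb X,\mathbb Y,\mathbb Z,\mathbb S$ be finite non-empty sets. A type on a finite set is the empirical distribution of a finite non-empty sequence of its elements, that is, a probability mass function with rational values. For $a\in\mathbb X$, $s\in\mathbb S$ let $p_{Y,Z|X,S}(\cdot,\cdot|a,s)$ be a conditional type on $\mathbb Y\times\mathbb Z$ (a conditional probability mass function with rational values), and let $Q$ be a type on $\mathbb Z$. This describes a compound discrete memoryless channel: the state $s$ is unknown to encoder and decoder and fixed during the whole block; on input $x^n$ the outputs $(y^n,z^n)$ have probability $\prod_{i=1}^n p_{Y,Z|X,S}(y_i,z_i|x_i,s)$. Write $J_s(b|a)=\sum_{c}p_{Y,Z|X,S}(b,c|a,s)$ and $K_s(c|a)=\sum_{b}p_{Y,Z|X,S}(b,c|a,s)$ for its marginals, and $V(P,P')=\sum_c|P(c)-P'(c)|$. A $(2^{nR},n)$-code consists of an encoder $\{1,\dots,\lceil 2^{nR}\rceil\}\to\mathbb X^n$ and a decoder $\mathbb Y^n\to\{1,\dots,\lceil 2^{nR}\rceil\}$; the message $M$ is uniformly distributed and $\hat M$ is the decoded message. A rate $R\ge 0$ is $(\Delta_s)_{s\in\mathbb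 S}$-achievable with interference type $Q$ if for every $\epsilon>0$ there is an $n_0$ such that for every $n>n_0$ there is a $(2^{nR},n)$-code with $\max_{s}\Pr(\hat M\ne M\mid s)<\epsilon$ and $\mathbb E_s\{V(Q,P_{z^n})\}\le\Delta_s$ for all $s$, where $\Pr(\cdot\mid s)$ and $\mathbb E_s$ refer to the channel state $s$ and $P_{z^n}$ is the type of the sequence $z^n$. Let $R^I(Q)\subseteq\mathbb R\times\mathbb R^{\mathbb S}$ be the closure of the set of all $(R,(\Delta_s)_s)$ such that $R\ge0$ is $(\Delta_s)_s$-achievable with interference type $Q$. For $\Delta\in\mathbb R^{\mathbb S}$ let $\mathcal N(\Delta)$ be the intersection over $s\in\mathbb S$ of the $\Delta_s$-pre-images of $Q$ under $K_s$, i.e. the set of all types $N$ on $\mathbb X$ such that for every $s$ the type $\sum_{a}N(a)K_s(\cdot|a)$ satisfies $V\big(Q,\sum_{a}N(a)K_s(\cdot|a)\big)\le\Delta_s$. Then $$R^I(Q)=\mathbf{Cl}\Big\{(R,(\Delta_s)_{s}):\ \mathcal N(\Delta)\neq\emptyset,\ 0\le R\le\sup_{N\in\mathcal N(\Delta)}\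 \min_{s\in\mathbb S} I(NJ_s)\Big\},$$ where $NJ_s$ is the joint distribution $N(a)J_s(b|a)$ on $\mathbb X\times\mathbb Y$ and $I$ is the mutual information in bits (logarithms to base $2$). -/

import Mathlib

open scoped BigOperators

noncomputable section

namespace InterferenceCoordination

/-! Types (empirical distributions) and conditional types over finite alphabets. A type and a
probability mass function are both represented by their real-valued function of values, so that a
matching PMF of a type is the same function. -/

/-- The type of a length-`n` sequence: relative frequency of each symbol. -/
def typeOf {A : Type*} [DecidableEq A] {n : ℕ} (x : Fin n → A) (a : A) : ℝ :=
  ((Finset.univ.filter fun i => x i = a).card : ℝ) / n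

/-- The set of all types on `A`, of any denominator `n ≥ 1`. -/
def types (A : Type*) [DecidableEq A] : Set (A → ℝ) :=
  {P | ∃ n : ℕ, 1 ≤ n ∧ ∃ x : Fin n → A, P = typeOf x}

/-- The set of all conditional types on `B` given `A`: the functions `J(b|a)` (written `J a b`) that
arise as `N(a,b|x,y) / N(a|x)` from sequences `x`, `y` of a common length `n ≥ 1`
in which every symbol `a` occurs in `x`. -/
def condTypes (A B : Type*) [DecidableEq A] [DecidableEq B] : Set (A → B → ℝ) :=
  {J | ∃ n : ℕ, 1 ≤ n ∧ ∃ (x : Fin n → A) (y : Fin n → B),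
    (∀ a, 0 < (Finset.univ.filter fun i => x i = a).card) ∧
    ∀ a b, J a b =
      ((Finset.univ.filter fun i => x i = a ∧ y i = b).card : ℝ) /
        ((Finset.univ.filter fun i => x i = a).card : ℝ)}

/-- Variational distance (without a factor one half). -/
def varDist {A : Type*} [Fintype A] (P Q : A → ℝ) : ℝ := ∑ a, |P a - Q a|

/-- The `Δ`-neighborhood of a type. -/
def neighborhood {A : Type*} [Fintype A] [DecidableEq A] (Δ : ℝ) (Q : A → ℝ) : Set (A → ℝ) :=
  {P | P ∈ types A ∧ varDist Q P ≤ Δ}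

/-- The `Δ`-pre-image of a type `Q` under a conditional type `J`. -/
def deltaPreimage {A B : Type*} [Fintype A] [DecidableEq A] [Fintype B] [DecidableEq B]
    (Δ : ℝ) (Q : B → ℝ) (J : A → B → ℝ) : Set (A → ℝ) :=
  {P | P ∈ types A ∧ (fun b => ∑ a, P a * J a b) ∈ neighborhood Δ Q}

/-- The joint type `N J`. -/
def jointType {A B : Type*} (P : A → ℝ) (J : A → B → ℝ) : A × B → ℝ :=
  fun ab => P ab.1 * J ab.1 ab.2

/-- Mutual information in bits: the relative entropy between `P` and the product of its marginals.
Terms with `P (a, b) = 0` vanish. -/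
def mutualInfo {A B : Type*} [Fintype A] [Fintype B] (P : A × B → ℝ) : ℝ :=
  ∑ a, ∑ b, P (a, b) *
    Real.logb 2 (P (a, b) / ((∑ b', P (a, b')) * (∑ a', P (a', b))))

section Channel

variable {X Y Z S : Type*}

/-- The marginal `p_{Y|X,S}(b|a,s)` of the compound channel `W (a, s) (b, c) = p(b,c|a,s)`. -/
def margY [Fintype Z] (W : X × S → Y × Z → ℝ) (s : S) (a : X) (b : Y) : ℝ := ∑ c, W (a, s) (b, c)

/-- The marginal `p_{Z|X,S}(c|a,s)` of the compound channel. -/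
def margZ [Fintype Y] (W : X × S → Y × Z → ℝ) (s : S) (a : X) (c : Z) : ℝ := ∑ b, W (a, s) (b, c)

/-- A code of blocklength `n` for `M` messages: a deterministic encoder and a decoder,
neither of which knows the channel state. -/
structure Code (X Y : Type*) (M n : ℕ) where
  enc : Fin M → Fin n → X
  dec : (Fin n → Y) → Fin M

/-- Number of messages of a `(2^{nR}, n)`-code, rounded up to an integer. -/
def numMessages (R : ℝ) (n : ℕ) : ℕ := ⌈(2 : ℝ) ^ ((n : ℝ) * R)⌉₊

/-- Joint law of the (uniform) message and the two output sequences, when `s` is the channel state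
throughout the block and the channel is memoryless. -/
def jointLaw (W : X × S → Y × Z → ℝ) (s : S) {M n : ℕ} (c : Code X Y M n)
    (m : Fin M) (y : Fin n → Y) (z : Fin n → Z) : ℝ :=
  (1 / (M : ℝ)) * ∏ i, W (c.enc m i, s) (y i, z i)

/-- Probability that the decoded message differs from the sent one when the state is `s`. -/
def errorProb [Fintype Y] [Fintype Z] (W : X × S → Y × Z → ℝ) (s : S) {M n : ℕ}
    (c : Code X Y M n) : ℝ :=
  ∑ m, ∑ y, ∑ z, if c.dec y ≠ m then jointLaw W s c m y z else 0

/-- The distribution of the observer's sequence induced by the code when the state is `s`. -/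
def inducedDist [Fintype Y] (W : X × S → Y × Z → ℝ) (s : S) {M n : ℕ}
    (c : Code X Y M n) (z : Fin n → Z) : ℝ :=
  ∑ m, ∑ y, jointLaw W s c m y z

/-- Expected variational distance between `Q` and the type of the observer's sequence
when the state is `s`. -/
def expectedDist [Fintype Y] [Fintype Z] [DecidableEq Z] (W : X × S → Y × Z → ℝ) (Q : Z → ℝ)
    (s : S) {M n : ℕ} (c : Code X Y M n) : ℝ :=
  ∑ z, inducedDist W s c z * varDist Q (typeOf z)

/-- The rate `R` is `(Δ_s)_s`-achievable with interference type `Q`. -/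
def Achievable [Fintype Y] [Fintype Z] [DecidableEq Z] (W : X × S → Y × Z → ℝ) (Q : Z → ℝ)
    (R : ℝ) (Δ : S → ℝ) : Prop :=
  ∀ ε : ℝ, 0 < ε → ∃ n₀ : ℕ, ∀ n : ℕ, n₀ < n → ∃ c : Code X Y (numMessages R n) n,
    (∀ s, errorProb W s c < ε) ∧ ∀ s, expectedDist W Q s c ≤ Δ s

/-- The communication-adaptive interference capacity region: the closure of the set of all
achievable tuples of a (nonnegative) rate and precisions. -/
def capacityRegion [Fintype Y] [Fintype Z] [DecidableEq Z] (W : X × S → Y × Z → ℝ) (Q : Z → ℝ) :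
    Set (ℝ × (S → ℝ)) :=
  closure {t | 0 ≤ t.1 ∧ Achievable W Q t.1 t.2}

/-- The input types that lie in the `Δ_s`-pre-image of `Q` under `p_{Z|X,S=s}` for every `s`. -/
def feasibleInputs [Fintype X] [DecidableEq X] [Fintype Y] [Fintype Z] [DecidableEq Z]
    (W : X × S → Y × Z → ℝ) (Q : Z → ℝ) (Δ : S → ℝ) : Set (X → ℝ) :=
  ⋂ s, deltaPreimage (Δ s) Q (margZ W s)

end Channel

end InterferenceCoordination

end

open InterferenceCoordination

/-!
Converse: let `N` be the type of the word formed by all codewords of a code. If the error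
probability in state `s` is at most `ε`, Fano's inequality against the output law of i.i.d. inputs
of distribution `N` gives `(1 - ε) log M - 1 ≤ n I(N J_s)`. The expected type of the interference
in state `s` is the output distribution of `N` under `K_s`, which by convexity of `V` lies within
`Δ_s` of `Q`. The same `N` serves all states at once.

Achievability: draw the codewords i.i.d. from `N` and accept a message if, in some state, the
likelihood of its codeword exceeds that of a random codeword by a factor `2 ^ (n γ)`. A wrong
codeword passes with probability at most `|S| 2 ^ (-n γ)`, and by the weak law of large numbers the
sent one passes with high probability if `γ < min_s I(N J_s)`. The interference is then i.i.d. with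
the output distribution of `N` under `K_s`, so its type converges to it. Averaging the sum over `s`
of error and interference deviation yields one codebook for all states. The slack needed in rate and
precision disappears in the closure.
-/

namespace InterferenceCoordination

open Filter Topology

/-! ### Finite distributions -/

section FiniteDistributions

variable {A B : Type*} [Fintype A] {p : A → ℝ}

/-- The mass that the distribution `p` on a finite type gives to the event `E`. -/
noncomputable def prob (p : A → ℝ) (E : Set A) : ℝ := ∑ a, E.indicator p a

lemma prob_eq_sum_mul (p : A → ℝ) (E : Set A) : prob p E = ∑ a, p a * E.indicator 1 a := by
  classical
  simp [prob, Set.indicator_apply]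

lemma prob_nonneg (hp : ∀ a, 0 ≤ p a) (E : Set A) : 0 ≤ prob p E :=
  Finset.sum_nonneg fun a _ => Set.indicator_nonneg (fun a _ => hp a) a

lemma prob_mono (hp : ∀ a, 0 ≤ p a) {E F : Set A} (h : ∀ a ∈ E, p a ≠ 0 → a ∈ F) :
    prob p E ≤ prob p F := by
  refine Finset.sum_le_sum fun a _ => Set.indicator_apply_le' (fun ha => ?_)
    fun _ => Set.indicator_nonneg (fun a _ => hp a) a
  rcases eq_or_ne (p a) 0 with h0 | h0
  · exact h0.trans_le (Set.indicator_nonneg (fun a _ => hp a) a)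
  · exact (Set.indicator_of_mem (h a ha h0) p).ge

lemma prob_union_le (hp : ∀ a, 0 ≤ p a) (E F : Set A) :
    prob p (E ∪ F) ≤ prob p E + prob p F := by
  simp only [prob, ← Finset.sum_add_distrib]
  refine Finset.sum_le_sum fun a _ => ?_
  rw [← Pi.add_apply, ← Set.indicator_union_add_inter p E F]
  exact le_add_of_nonneg_right (Set.indicator_nonneg (fun a _ => hp a) a)

lemma prob_biUnion_le (hp : ∀ a, 0 ≤ p a) {ι : Type*} (t : Finset ι) (E : ι → Set A) :
    prob p (⋃ i ∈ t, E i) ≤ ∑ i ∈ t, prob p (E i) := by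
  classical
  induction t using Finset.induction_on with
  | empty => simp [prob]
  | insert i t hi ih =>
    rw [Finset.set_biUnion_insert, Finset.sum_insert hi]
    exact (prob_union_le hp _ _).trans (by gcongr)

lemma prob_add_prob_compl (p : A → ℝ) (E : Set A) : prob p E + prob p Eᶜ = ∑ a, p a := by
  rw [prob, prob, ← Finset.sum_add_distrib]
  exact Finset.sum_congr rfl fun a _ => congrFun (Set.indicator_self_add_compl E p) a

lemma mul_prob_le_sum_mul (hp : ∀ a, 0 ≤ p a) {f : A → ℝ} (hf : ∀ a, 0 ≤ f a) {t : ℝ}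
    {E : Set A} (h : ∀ a ∈ E, t ≤ f a) : t * prob p E ≤ ∑ a, p a * f a := by
  rw [prob, Finset.mul_sum]
  refine Finset.sum_le_sum fun a _ => ?_
  by_cases ha : a ∈ E
  · rw [Set.indicator_of_mem ha, mul_comm]
    exact mul_le_mul_of_nonneg_left (h a ha) (hp a)
  · rw [Set.indicator_of_notMem ha, mul_zero]
    exact mul_nonneg (hp a) (hf a)

lemma exists_le_of_sum_mul_le (hp : p ∈ stdSimplex ℝ A) {f : A → ℝ} {c : ℝ}
    (h : ∑ a, p a * f a ≤ c) : ∃ a, f a ≤ c := by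
  by_contra! hlt
  exact h.not_gt ((convex_Ioi c).sum_mem (fun a _ => hp.1 a) hp.2 fun a _ => hlt a)

/-- The distribution of the output of the channel `J` when its input has distribution `P`. -/
def outputDist (P : A → ℝ) (J : A → B → ℝ) (b : B) : ℝ := ∑ a, P a * J a b

lemma outputDist_mem_stdSimplex [Fintype B] {P : A → ℝ} (hP : P ∈ stdSimplex ℝ A) {J : A → B → ℝ}
    (hJ : ∀ a, J a ∈ stdSimplex ℝ B) : outputDist P J ∈ stdSimplex ℝ B := by
  have h := (convex_stdSimplex ℝ B).sum_mem (fun a _ => hP.1 a) hP.2 fun a _ => hJ a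
  convert h using 1
  ext b
  simp [outputDist]

lemma sum_outputDist_mul [Fintype B] (P : A → ℝ) (J : A → B → ℝ) (f : B → ℝ) :
    ∑ b, outputDist P J b * f b = ∑ a, P a * ∑ b, J a b * f b := by
  simp only [outputDist, Finset.sum_mul, Finset.mul_sum, mul_assoc]
  exact Finset.sum_comm

lemma sum_mul_prob_comm [Fintype B] (p : A → ℝ) (q : B → ℝ) (C : A → Set B) :
    ∑ a, p a * prob q (C a) = ∑ b, q b * prob p {a | b ∈ C a} := by
  simp only [prob_eq_sum_mul, Finset.mul_sum]
  rw [Finset.sum_comm]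
  refine Finset.sum_congr rfl fun b _ => Finset.sum_congr rfl fun a _ => ?_
  have hswap : (C a).indicator (1 : B → ℝ) b = {a | b ∈ C a}.indicator 1 a := rfl
  rw [hswap]
  ring

lemma mul_le_outputDist {P : A → ℝ} (hP : ∀ a, 0 ≤ P a) {J : A → B → ℝ} (hJ : ∀ a b, 0 ≤ J a b)
    (a : A) (b : B) : P a * J a b ≤ outputDist P J b :=
  Finset.single_le_sum (f := fun a => P a * J a b) (fun a _ => mul_nonneg (hP a) (hJ a b))
    (Finset.mem_univ a)

lemma support_subset_support_outputDist {P : A → ℝ} (hP : ∀ a, 0 ≤ P a) {J : A → B → ℝ}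
    (hJ : ∀ a b, 0 ≤ J a b) {a : A} (ha : 0 < P a) :
    (J a).support ⊆ (outputDist P J).support := fun b hb =>
  ((mul_pos ha ((hJ a b).lt_of_ne' hb)).trans_le (mul_le_outputDist hP hJ a b)).ne'

end FiniteDistributions

/-! ### Product distributions -/

section ProductDistributions

variable {ι A B : Type*} [Fintype ι]

/-- The law of a family of independent letters, the `i`-th one with distribution `p i`. -/
def prodDist (p : ι → A → ℝ) (y : ι → A) : ℝ := ∏ i, p i (y i)

/-- The memoryless extension of the channel `J` to words: given the input word `x`, the output
letters are independent, the `i`-th one with distribution `J (x i)`. -/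
def memoryless (J : A → B → ℝ) (x : ι → A) : (ι → B) → ℝ := prodDist fun i => J (x i)

lemma support_prodDist_subset {p q : ι → A → ℝ} (h : ∀ i, (p i).support ⊆ (q i).support) :
    (prodDist p).support ⊆ (prodDist q).support := fun _ hy =>
  Finset.prod_ne_zero_iff.2 fun i hi => h i (Finset.prod_ne_zero_iff.1 hy i hi)

variable [DecidableEq ι] [Fintype A] {p : ι → A → ℝ}

lemma sum_prodDist_mul_prod (p f : ι → A → ℝ) :
    ∑ y, prodDist p y * ∏ i, f i (y i) = ∏ i, ∑ a, p i a * f i a := by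
  simp only [prodDist, Fintype.prod_sum, Finset.prod_mul_distrib]

lemma sum_prodDist (p : ι → A → ℝ) : ∑ y, prodDist p y = ∏ i, ∑ a, p i a := by
  simpa using sum_prodDist_mul_prod p 1

lemma prodDist_mem_stdSimplex (hp : ∀ i, p i ∈ stdSimplex ℝ A) :
    prodDist p ∈ stdSimplex ℝ (ι → A) :=
  ⟨fun _ => Finset.prod_nonneg fun i _ => (hp i).1 _,
    (sum_prodDist p).trans (Finset.prod_eq_one fun i _ => (hp i).2)⟩

lemma memoryless_mem_stdSimplex {A : Type*} [Fintype B] {J : A → B → ℝ}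
    (hJ : ∀ a, J a ∈ stdSimplex ℝ B) (x : ι → A) : memoryless J x ∈ stdSimplex ℝ (ι → B) :=
  prodDist_mem_stdSimplex fun i => hJ (x i)

lemma outputDist_memoryless (P : A → ℝ) (J : A → B → ℝ) :
    outputDist (prodDist fun _ : ι => P) (memoryless J) = prodDist fun _ => outputDist P J := by
  ext y
  exact sum_prodDist_mul_prod (fun _ => P) fun i a => J a (y i)

lemma prob_prodDist_jointType [Fintype B] (P : A → ℝ) (J : A → B → ℝ)
    (E : (ι → A) → Set (ι → B)) :
    prob (prodDist fun _ : ι => jointType P J) {w | (fun i => (w i).2) ∈ E fun i => (w i).1} =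
      ∑ x, prodDist (fun _ => P) x * prob (memoryless J x) (E x) := by
  simp only [prob_eq_sum_mul, Finset.mul_sum]
  rw [← (Equiv.arrowProdEquivProdArrow ι (fun _ => A) fun _ => B).symm.sum_comp,
    Fintype.sum_prod_type]
  refine Finset.sum_congr rfl fun x _ => Finset.sum_congr rfl fun y _ => ?_
  rw [← mul_assoc, memoryless, prodDist, prodDist, prodDist, ← Finset.prod_mul_distrib]
  rfl

lemma sum_prodDist_mul_apply (hp : ∀ i, ∑ a, p i a = 1) (k : ι) (f : A → ℝ) :
    ∑ y, prodDist p y * f (y k) = ∑ a, p k a * f a := by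
  have h := sum_prodDist_mul_prod p (Function.update 1 k f)
  rw [Fintype.prod_eq_single k fun i hi => by simp [hi, hp]] at h
  have hprod (y : ι → A) : ∏ i, (Function.update 1 k f : ι → A → ℝ) i (y i) = f (y k) := by
    rw [Fintype.prod_eq_single k fun i hi => by simp [hi], Function.update_self]
  simpa [hprod] using h

lemma sum_prodDist_mul_apply_mul_apply (hp : ∀ i, ∑ a, p i a = 1) {k l : ι} (hkl : k ≠ l)
    (f g : A → ℝ) :
    ∑ y, prodDist p y * (f (y k) * g (y l)) = (∑ a, p k a * f a) * ∑ a, p l a * g a := by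
  have h := sum_prodDist_mul_prod p (Function.update (Function.update 1 k f) l g)
  rw [Fintype.prod_eq_mul k l hkl fun i hi => by simp [hi.1, hi.2, hp]] at h
  have hprod (y : ι → A) :
      ∏ i, (Function.update (Function.update 1 k f) l g : ι → A → ℝ) i (y i) =
        f (y k) * g (y l) := by
    rw [Fintype.prod_eq_mul k l hkl fun i hi => by simp [hi.1, hi.2]]
    simp [hkl]
  simpa [hprod, hkl] using h

lemma sum_prodDist_mul_apply_apply (hp : ∀ i, ∑ a, p i a = 1) {k l : ι} (hkl : k ≠ l)
    (h : A → A → ℝ) :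
    ∑ y, prodDist p y * h (y k) (y l) = ∑ a, p k a * ∑ b, p l b * h a b := by
  classical
  have hsum (y : ι → A) :
      h (y k) (y l) = ∑ a, (if y k = a then 1 else 0) * h a (y l) := by simp
  simp only [hsum]
  simp only [Finset.mul_sum (Finset.univ : Finset A) _ (prodDist p _)]
  rw [Finset.sum_comm]
  refine Finset.sum_congr rfl fun a _ => ?_
  rw [sum_prodDist_mul_apply_mul_apply hp hkl (fun b => if b = a then 1 else 0) (h a)]
  simp

end ProductDistributions

/-! ### The weak law of large numbers -/

section WeakLaw

variable {A : Type*} [Fintype A] {p : A → ℝ}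

lemma sum_prodDist_mul_sum_sq {ι : Type*} [Fintype ι] [DecidableEq ι] (hp : ∑ a, p a = 1)
    {f : A → ℝ} (hf : ∑ a, p a * f a = 0) :
    ∑ y, prodDist (fun _ : ι => p) y * (∑ i, f (y i)) ^ 2 =
      Fintype.card ι * ∑ a, p a * f a ^ 2 := by
  have hcross (k l : ι) : ∑ y, prodDist (fun _ : ι => p) y * (f (y k) * f (y l)) =
      if k = l then ∑ a, p a * f a ^ 2 else 0 := by
    split_ifs with hkl
    · simpa only [hkl, sq] using sum_prodDist_mul_apply (fun _ => hp) l fun a => f a * f a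
    · rw [sum_prodDist_mul_apply_mul_apply (fun _ => hp) hkl, hf, zero_mul]
  calc ∑ y, prodDist (fun _ : ι => p) y * (∑ i, f (y i)) ^ 2
      = ∑ y, ∑ k, ∑ l, prodDist (fun _ : ι => p) y * (f (y k) * f (y l)) := by
        simp only [sq, Finset.sum_mul_sum]
        simp only [Finset.mul_sum]
    _ = ∑ k, ∑ l, ∑ y, prodDist (fun _ : ι => p) y * (f (y k) * f (y l)) := by
        rw [Finset.sum_comm]
        exact Finset.sum_congr rfl fun k _ => Finset.sum_comm
    _ = Fintype.card ι * ∑ a, p a * f a ^ 2 := by simp [hcross]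

lemma sum_prodDist_mul_abs_sub_mean_le (hp : p ∈ stdSimplex ℝ A) (f : A → ℝ) {n : ℕ}
    (hn : n ≠ 0) :
    ∑ y, prodDist (fun _ : Fin n => p) y * |∑ a, p a * f a - (∑ i, f (y i)) / n| ≤
      √((∑ a, p a * (∑ b, p b * f b - f a) ^ 2) / n) := by
  have hn' : (n : ℝ) ≠ 0 := Nat.cast_ne_zero.2 hn
  have hq : prodDist (fun _ : Fin n => p) ∈ stdSimplex ℝ (Fin n → A) :=
    prodDist_mem_stdSimplex fun _ => hp
  set μ := ∑ a, p a * f a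
  have hcenter : ∑ a, p a * (μ - f a) = 0 := by
    simp only [mul_sub, Finset.sum_sub_distrib, ← Finset.sum_mul, hp.2, one_mul, μ, sub_self]
  have hmean (y : Fin n → A) : μ - (∑ i, f (y i)) / n = (∑ i, (μ - f (y i))) / n := by
    rw [Finset.sum_sub_distrib, Fin.sum_const, nsmul_eq_mul]
    field_simp
  refine Real.le_sqrt_of_sq_le ?_
  calc (∑ y, prodDist (fun _ : Fin n => p) y * |μ - (∑ i, f (y i)) / n|) ^ 2
      ≤ ∑ y, prodDist (fun _ : Fin n => p) y * |μ - (∑ i, f (y i)) / n| ^ 2 :=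
        Real.pow_arith_mean_le_arith_mean_pow _ _ _ (fun y _ => hq.1 y) hq.2
          (fun _ _ => abs_nonneg _) 2
    _ = (∑ y, prodDist (fun _ : Fin n => p) y * (∑ i, (μ - f (y i))) ^ 2) / n ^ 2 := by
        simp only [sq_abs, hmean, div_pow]
        simp only [Finset.sum_div, mul_div_assoc]
    _ = (∑ a, p a * (μ - f a) ^ 2) / n := by
        rw [sum_prodDist_mul_sum_sq hp.2 hcenter, Fintype.card_fin]
        field_simp

lemma tendsto_sum_prodDist_mul_abs_sub_mean (hp : p ∈ stdSimplex ℝ A) (f : A → ℝ) :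
    Tendsto (fun n : ℕ => ∑ y, prodDist (fun _ : Fin n => p) y *
      |∑ a, p a * f a - (∑ i, f (y i)) / n|) atTop (𝓝 0) := by
  have hbound : Tendsto (fun n : ℕ => √((∑ a, p a * (∑ b, p b * f b - f a) ^ 2) / n)) atTop
      (𝓝 0) := by
    simpa using (tendsto_const_div_atTop_nhds_zero_nat _).sqrt
  refine squeeze_zero' (.of_forall fun n => ?_) ?_ hbound
  · exact Finset.sum_nonneg fun y _ =>
      mul_nonneg ((prodDist_mem_stdSimplex fun _ => hp).1 y) (abs_nonneg _)
  · filter_upwards [eventually_ne_atTop 0] with n hn using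
      sum_prodDist_mul_abs_sub_mean_le hp f hn

lemma tendsto_prob_sum_le (hp : p ∈ stdSimplex ℝ A) {f : A → ℝ} {γ : ℝ}
    (hγ : γ < ∑ a, p a * f a) :
    Tendsto (fun n : ℕ => prob (prodDist fun _ : Fin n => p) {y | ∑ i, f (y i) ≤ γ * n}) atTop
      (𝓝 0) := by
  set μ := ∑ a, p a * f a
  have hd : 0 < μ - γ := sub_pos.2 hγ
  have hlim := (tendsto_sum_prodDist_mul_abs_sub_mean hp f).const_mul (μ - γ)⁻¹
  rw [mul_zero] at hlim
  have hq (n : ℕ) := (prodDist_mem_stdSimplex fun _ : Fin n => hp).1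
  refine squeeze_zero' (.of_forall fun n => ?_) ?_ hlim
  · exact prob_nonneg (hq n) _
  · filter_upwards [eventually_gt_atTop 0] with n hn
    rw [← div_eq_inv_mul, le_div_iff₀' hd]
    refine mul_prob_le_sum_mul (hq n) (fun _ => abs_nonneg _) fun y hy => ?_
    have hy' : (∑ i, f (y i)) / n ≤ γ := (div_le_iff₀ (by exact_mod_cast hn)).2 hy
    exact (sub_le_sub_left hy' μ).trans (le_abs_self _)

end WeakLaw

/-! ### Types and variational distance -/

section Types

lemma exists_common_denominator {A : Type*} [Finite A] {P : A → ℝ} (hP : ∀ a, 0 ≤ P a)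
    (hrat : ∀ a, P a ∈ (Rat.castHom ℝ).fieldRange) :
    ∃ d : ℕ, d ≠ 0 ∧ ∃ k : A → ℕ, ∀ a, P a = k a / d := by
  classical
  have := Fintype.ofFinite A
  choose q hq using hrat
  simp only [Rat.coe_castHom] at hq
  have hq0 (a : A) : 0 ≤ q a := by
    have h := hP a
    rw [← hq a] at h
    exact_mod_cast h
  lift q to A → ℚ≥0 using hq0
  simp only [NNRat.cast_def, Rat.cast_div, Rat.cast_natCast] at hq
  refine ⟨∏ a, (q a).den, Finset.prod_ne_zero_iff.2 fun a _ => (q a).den_ne_zero,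
    fun a => (q a).num * ∏ b ∈ Finset.univ.erase a, (q b).den, fun a => ?_⟩
  have hrest : (∏ b ∈ Finset.univ.erase a, ((q b).den : ℝ)) ≠ 0 :=
    Finset.prod_ne_zero_iff.2 fun b _ => Nat.cast_ne_zero.2 (q b).den_ne_zero
  rw [← hq a, ← Finset.mul_prod_erase _ _ (Finset.mem_univ a)]
  push_cast
  rw [mul_div_mul_right _ _ hrest]

variable {A B : Type*} [DecidableEq A]

lemma typeOf_eq_sum {n : ℕ} (x : Fin n → A) (a : A) :
    typeOf x a = (∑ i, if x i = a then 1 else 0) / n := by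
  simp [typeOf]

lemma sum_typeOf_mul [Fintype A] {n : ℕ} (x : Fin n → A) (f : A → ℝ) :
    ∑ a, typeOf x a * f a = (∑ i, f (x i)) / n := by
  simp only [typeOf_eq_sum, div_mul_eq_mul_div, ← Finset.sum_div, Finset.sum_mul, ite_mul, one_mul,
    zero_mul]
  rw [Finset.sum_comm]
  simp

lemma typeOf_apply_pos {n : ℕ} (x : Fin n → A) (i : Fin n) : 0 < typeOf x (x i) := by
  have hn : 0 < n := i.pos
  have hcount : 0 < (Finset.univ.filter fun j => x j = x i).card :=
    Finset.card_pos.2 ⟨i, by simp⟩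
  unfold typeOf
  positivity

lemma typeOf_mem_stdSimplex [Fintype A] {n : ℕ} (hn : n ≠ 0) (x : Fin n → A) :
    typeOf x ∈ stdSimplex ℝ A := by
  refine ⟨fun a => by unfold typeOf; positivity, ?_⟩
  simpa [hn] using sum_typeOf_mul x 1

lemma exists_typeOf_eq_div [Fintype A] (k : A → ℕ) :
    ∃ x : Fin (∑ a, k a) → A, ∀ a, typeOf x a = k a / (∑ b, k b : ℕ) := by
  have e : Fin (∑ a, k a) ≃ Σ a, Fin (k a) := Fintype.equivOfCardEq (by simp)
  refine ⟨fun i => (e i).1, fun a => ?_⟩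
  rw [typeOf_eq_sum, e.sum_comp fun w => if w.1 = a then (1 : ℝ) else 0, Fintype.sum_sigma]
  have hblock (b : A) : ∑ _j : Fin (k b), (if b = a then (1 : ℝ) else 0) =
      if b = a then (k b : ℝ) else 0 := by
    simp
  simp only [hblock, Finset.sum_ite_eq', Finset.mem_univ, if_true]

lemma mem_types_iff [Fintype A] {P : A → ℝ} :
    P ∈ types A ↔ P ∈ stdSimplex ℝ A ∧ ∀ a, P a ∈ (Rat.castHom ℝ).fieldRange := by
  constructor
  · rintro ⟨n, hn, x, rfl⟩
    exact ⟨typeOf_mem_stdSimplex (by lia) x, fun a => div_mem (natCast_mem _ _) (natCast_mem _ _)⟩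
  · rintro ⟨hP, hrat⟩
    obtain ⟨d, hd, k, hk⟩ := exists_common_denominator hP.1 hrat
    have hsum : ∑ a, k a = d := by
      have h := hP.2
      simp only [hk, ← Finset.sum_div] at h
      exact_mod_cast (div_eq_one_iff_eq (Nat.cast_ne_zero.2 hd)).1 h
    obtain ⟨x, hx⟩ := exists_typeOf_eq_div k
    subst hsum
    exact ⟨_, Nat.one_le_iff_ne_zero.2 hd, x, funext fun a => (hk a).trans (hx a).symm⟩

lemma condTypes_mem_stdSimplex [Fintype B] [DecidableEq B] {J : A → B → ℝ}
    (hJ : J ∈ condTypes A B) (a : A) : J a ∈ stdSimplex ℝ B := by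
  obtain ⟨n, -, x, y, hx, hJ⟩ := hJ
  refine ⟨fun b => by rw [hJ]; positivity, ?_⟩
  simp only [hJ, ← Finset.sum_div]
  rw [div_eq_one_iff_eq (Nat.cast_ne_zero.2 (hx a).ne'),
    Finset.card_eq_sum_card_fiberwise (f := y) (t := Finset.univ) (by simp)]
  simp [Finset.filter_filter]

lemma condTypes_mem_fieldRange [DecidableEq B] {J : A → B → ℝ} (hJ : J ∈ condTypes A B)
    (a : A) (b : B) : J a b ∈ (Rat.castHom ℝ).fieldRange := by
  obtain ⟨n, -, x, y, -, hJ⟩ := hJ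
  rw [hJ]
  exact div_mem (natCast_mem _ _) (natCast_mem _ _)

lemma outputDist_mem_types [Fintype A] [Finite B] [DecidableEq B] {P : A → ℝ} (hP : P ∈ types A)
    {J : A → B → ℝ} (hJ : ∀ a, J a ∈ types B) : outputDist P J ∈ types B := by
  have := Fintype.ofFinite B
  simp only [mem_types_iff] at hP hJ ⊢
  exact ⟨outputDist_mem_stdSimplex hP.1 fun a => (hJ a).1,
    fun b => sum_mem fun a _ => mul_mem (hP.2 a) ((hJ a).2 b)⟩

end Types

section VarDist

variable {A B : Type*} [Fintype A] [Fintype B]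

lemma varDist_triangle (P Q R : A → ℝ) : varDist P R ≤ varDist P Q + varDist Q R := by
  simp only [varDist, ← Finset.sum_add_distrib]
  exact Finset.sum_le_sum fun a _ => abs_sub_le _ _ _

lemma varDist_outputDist_le {p : A → ℝ} (hp : p ∈ stdSimplex ℝ A) (Q : B → ℝ)
    (F : A → B → ℝ) : varDist Q (outputDist p F) ≤ ∑ a, p a * varDist Q (F a) := by
  have hb (b : B) : |Q b - outputDist p F b| ≤ ∑ a, p a * |Q b - F a b| := by
    have hQ : Q b - outputDist p F b = ∑ a, p a * (Q b - F a b) := by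
      simp only [mul_sub, Finset.sum_sub_distrib, ← Finset.sum_mul, hp.2, one_mul, outputDist]
    rw [hQ]
    refine (Finset.abs_sum_le_sum_abs _ _).trans_eq (Finset.sum_congr rfl fun a _ => ?_)
    rw [abs_mul, abs_of_nonneg (hp.1 a)]
  simp only [varDist, Finset.mul_sum]
  rw [Finset.sum_comm]
  simpa only [Finset.mul_sum] using Finset.sum_le_sum fun b _ => hb b

lemma tendsto_sum_prodDist_mul_varDist_typeOf [DecidableEq A] {p : A → ℝ}
    (hp : p ∈ stdSimplex ℝ A) :
    Tendsto (fun n : ℕ => ∑ y, prodDist (fun _ : Fin n => p) y * varDist p (typeOf y)) atTop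
      (𝓝 0) := by
  have hletter (a : A) : Tendsto (fun n : ℕ => ∑ y, prodDist (fun _ : Fin n => p) y *
      |p a - typeOf y a|) atTop (𝓝 0) := by
    simpa [typeOf_eq_sum] using
      tendsto_sum_prodDist_mul_abs_sub_mean hp fun b => if b = a then 1 else 0
  have hsum := tendsto_finsetSum Finset.univ fun a _ => hletter a
  simp only [Finset.sum_const_zero] at hsum
  refine hsum.congr fun n => ?_
  rw [Finset.sum_comm]
  simp only [varDist, Finset.mul_sum]

end VarDist

/-! ### Relative entropy and mutual information -/

section RelativeEntropy

variable {A B : Type*} [Fintype A] {p q : A → ℝ}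

/-- The relative entropy of `p` with respect to `q` in bits. Terms with `p a = 0` vanish; the
value is the usual one only if the support of `p` is contained in that of `q`. -/
noncomputable def relEntropy (p q : A → ℝ) : ℝ := ∑ a, p a * Real.logb 2 (p a / q a)

lemma relEntropy_nonneg (hp : p ∈ stdSimplex ℝ A) (hq : q ∈ stdSimplex ℝ A)
    (hpq : p.support ⊆ q.support) : 0 ≤ relEntropy p q := by
  have hterm (a : A) : p a - q a ≤ p a * Real.log (p a / q a) := by
    rcases (hp.1 a).eq_or_lt with ha | ha
    · simpa [← ha] using hq.1 a
    · have hqa : 0 < q a := (hq.1 a).lt_of_ne' (hpq ha.ne')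
      calc p a - q a = p a * (1 - (p a / q a)⁻¹) := by field_simp
        _ ≤ p a * Real.log (p a / q a) :=
          mul_le_mul_of_nonneg_left (Real.one_sub_inv_le_log_of_pos (by positivity)) ha.le
  have hsum : 0 ≤ ∑ a, p a * Real.log (p a / q a) := by
    simpa only [Finset.sum_sub_distrib, hp.2, hq.2, sub_self] using
      Finset.sum_le_sum fun a (_ : a ∈ Finset.univ) => hterm a
  simpa only [relEntropy, Real.logb, mul_div_assoc', ← Finset.sum_div] using
    div_nonneg hsum (Real.log_nonneg one_le_two)

lemma sum_mul_logb_le_relEntropy (hp : p ∈ stdSimplex ℝ A) (hq : ∀ a, 0 ≤ q a)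
    (hpq : p.support ⊆ q.support) {w : A → ℝ} (hw : ∀ a, 0 < w a) (hqw : ∑ a, q a * w a = 1) :
    ∑ a, p a * Real.logb 2 (w a) ≤ relEntropy p q := by
  have htilt : 0 ≤ relEntropy p fun a => q a * w a :=
    relEntropy_nonneg hp ⟨fun a => mul_nonneg (hq a) (hw a).le, hqw⟩
      fun a ha => mul_ne_zero (hpq ha) (hw a).ne'
  have hsplit (a : A) : p a * Real.logb 2 (p a / (q a * w a)) =
      p a * Real.logb 2 (p a / q a) - p a * Real.logb 2 (w a) := by
    rcases eq_or_ne (p a) 0 with ha | ha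
    · simp [ha]
    · rw [← div_div, Real.logb_div (div_ne_zero ha (hpq ha)) (hw a).ne', mul_sub]
  rw [← sub_nonneg]
  simpa only [relEntropy, hsplit, Finset.sum_sub_distrib] using htilt

lemma prob_mul_logb_sub_one_le_relEntropy (hp : p ∈ stdSimplex ℝ A) (hq : q ∈ stdSimplex ℝ A)
    (hpq : p.support ⊆ q.support) {E : Set A} {M : ℝ} (hM : 0 < M) (hE : prob q E * M = 1) :
    prob p E * Real.logb 2 M - 1 ≤ relEntropy p q := by
  -- Averaging `q` with its conditioning on `E` keeps the mass 1 and gains at least `M / 2` on `E`.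
  let w : A → ℝ := fun a => (1 + E.indicator 1 a * M) / 2
  have hind (a : A) : 0 ≤ E.indicator (1 : A → ℝ) a :=
    Set.indicator_nonneg (fun _ _ => zero_le_one) a
  have hw (a : A) : 0 < w a := by
    have := hind a
    positivity
  have hqw : ∑ a, q a * w a = 1 := by
    calc ∑ a, q a * w a = (∑ a, q a + (∑ a, q a * E.indicator 1 a) * M) / 2 := by
          simp only [w, Finset.sum_mul, ← Finset.sum_add_distrib, Finset.sum_div]
          exact Finset.sum_congr rfl fun a _ => by ring
      _ = 1 := by rw [← prob_eq_sum_mul, hq.2, hE]; norm_num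
  have hlog (a : A) : E.indicator 1 a * Real.logb 2 M - 1 ≤ Real.logb 2 (w a) := by
    have hwa := hw a
    simp only [w] at hwa ⊢
    rw [Real.logb_div (by linarith) two_ne_zero, Real.logb_self_eq_one one_lt_two]
    by_cases ha : a ∈ E
    · simpa [ha] using Real.logb_le_logb_of_le one_lt_two hM (le_add_of_nonneg_left zero_le_one)
    · simp [ha]
  calc prob p E * Real.logb 2 M - 1 = ∑ a, p a * (E.indicator 1 a * Real.logb 2 M - 1) := by
        simp only [mul_sub, Finset.sum_sub_distrib, mul_one, hp.2, prob_eq_sum_mul,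
          Finset.sum_mul, mul_assoc]
    _ ≤ ∑ a, p a * Real.logb 2 (w a) :=
        Finset.sum_le_sum fun a _ => mul_le_mul_of_nonneg_left (hlog a) (hp.1 a)
    _ ≤ relEntropy p q := sum_mul_logb_le_relEntropy hp hq.1 hpq hw hqw

lemma mul_relEntropy_le {c : ℝ} (hc : 0 ≤ c) (hp : p ∈ stdSimplex ℝ A) (hq : ∀ a, 0 ≤ q a)
    (h : ∀ a, c * p a ≤ q a) : c * relEntropy p q ≤ (Real.log 2)⁻¹ := by
  have hterm (a : A) : c * (p a * Real.logb 2 (p a / q a)) ≤ (Real.log 2)⁻¹ * p a := by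
    have hpa := hp.1 a
    calc c * (p a * Real.logb 2 (p a / q a))
        = (Real.log 2)⁻¹ * p a * (c * Real.log (p a / q a)) := by rw [Real.logb]; ring
      _ ≤ (Real.log 2)⁻¹ * p a * (c * (p a / q a)) := by
          gcongr
          exact Real.log_le_self (div_nonneg hpa (hq a))
      _ ≤ (Real.log 2)⁻¹ * p a * 1 := by
          gcongr
          rw [mul_div_assoc']
          exact div_le_one_of_le₀ (h a) (hq a)
      _ = (Real.log 2)⁻¹ * p a := mul_one _
  calc c * relEntropy p q ≤ ∑ a, (Real.log 2)⁻¹ * p a := by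
        rw [relEntropy, Finset.mul_sum]
        exact Finset.sum_le_sum fun a _ => hterm a
    _ = (Real.log 2)⁻¹ := by rw [← Finset.mul_sum, hp.2, mul_one]

lemma relEntropy_prodDist {ι : Type*} [Fintype ι] [DecidableEq ι] {p q : ι → A → ℝ}
    (hp : ∀ i, ∑ a, p i a = 1) (hpq : ∀ i, (p i).support ⊆ (q i).support) :
    relEntropy (prodDist p) (prodDist q) = ∑ i, relEntropy (p i) (q i) := by
  have hlog (y : ι → A) : prodDist p y * Real.logb 2 (prodDist p y / prodDist q y) =
      ∑ i, prodDist p y * Real.logb 2 (p i (y i) / q i (y i)) := by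
    rcases eq_or_ne (prodDist p y) 0 with hy | hy
    · simp [hy]
    · have hp' (i : ι) : p i (y i) ≠ 0 := Finset.prod_ne_zero_iff.1 hy i (Finset.mem_univ i)
      rw [← Finset.mul_sum, prodDist, prodDist, ← Finset.prod_div_distrib,
        Real.logb_prod _ _ fun i _ => div_ne_zero (hp' i) (hpq i (hp' i))]
  simp only [relEntropy, hlog]
  rw [Finset.sum_comm]
  exact Finset.sum_congr rfl fun i _ =>
    sum_prodDist_mul_apply hp i fun a => Real.logb 2 (p i a / q i a)

lemma mutualInfo_jointType [Fintype B] (P : A → ℝ) {J : A → B → ℝ} (hJ : ∀ a, ∑ b, J a b = 1) :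
    mutualInfo (jointType P J) = ∑ a, P a * relEntropy (J a) (outputDist P J) := by
  simp only [mutualInfo, jointType, relEntropy, outputDist]
  refine Finset.sum_congr rfl fun a _ => ?_
  rw [Finset.mul_sum]
  refine Finset.sum_congr rfl fun b _ => ?_
  rcases eq_or_ne (P a) 0 with ha | ha
  · simp [ha]
  · rw [← Finset.mul_sum, hJ, mul_one, mul_div_mul_left _ _ ha, mul_assoc]

lemma mutualInfo_jointType_le [Fintype B] {P : A → ℝ} (hP : ∀ a, 0 ≤ P a) {J : A → B → ℝ}
    (hJ : ∀ a, J a ∈ stdSimplex ℝ B) :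
    mutualInfo (jointType P J) ≤ Fintype.card A * (Real.log 2)⁻¹ := by
  rw [mutualInfo_jointType P fun a => (hJ a).2, ← nsmul_eq_mul]
  refine Finset.sum_le_card_nsmul _ _ _ fun a _ => ?_
  exact mul_relEntropy_le (hP a) (hJ a)
    (fun b => Finset.sum_nonneg fun a _ => mul_nonneg (hP a) ((hJ a).1 b))
    (mul_le_outputDist hP (fun a => (hJ a).1) a)

end RelativeEntropy

/-! ### One-shot bounds for channel codes -/

section Fano

variable {μ B : Type*} [Fintype μ] [Nonempty μ] [Fintype B]

lemma fano_inequality {K : μ → B → ℝ} (hK : ∀ m, K m ∈ stdSimplex ℝ B) {q : B → ℝ}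
    (hq : q ∈ stdSimplex ℝ B) (hKq : ∀ m, (K m).support ⊆ q.support) (d : B → μ) :
    (1 - (∑ m, prob (K m) {y | d y ≠ m}) / Fintype.card μ) * Real.logb 2 (Fintype.card μ) - 1 ≤
      (∑ m, relEntropy (K m) q) / Fintype.card μ := by
  classical
  set M : ℝ := (Fintype.card μ : ℝ)
  have hM : 0 < M := Nat.cast_pos.2 Fintype.card_pos
  let p : μ × B → ℝ := fun v => K v.1 v.2 / M
  let r : μ × B → ℝ := fun v => q v.2 / M
  let E : Set (μ × B) := {v | d v.2 = v.1}
  have hp : p ∈ stdSimplex ℝ (μ × B) := by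
    refine ⟨fun v => div_nonneg ((hK v.1).1 v.2) hM.le, ?_⟩
    simp [Fintype.sum_prod_type, p, ← Finset.sum_div, (hK _).2, M]
  have hr : r ∈ stdSimplex ℝ (μ × B) := by
    refine ⟨fun v => div_nonneg (hq.1 v.2) hM.le, ?_⟩
    simp [Fintype.sum_prod_type, r, ← Finset.sum_div, hq.2, M]
  have hpr : p.support ⊆ r.support := fun v hv =>
    div_ne_zero (hKq v.1 (div_ne_zero_iff.1 hv).1) hM.ne'
  have hrE : prob r E * M = 1 := by
    simp [prob, Set.indicator_apply, Fintype.sum_prod_type_right, r, E, ← Finset.sum_div, hq.2,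
      hM.ne']
  have hpE : 1 - (∑ m, prob (K m) {y | d y ≠ m}) / M = prob p E := by
    have herr : prob p Eᶜ = (∑ m, prob (K m) {y | d y ≠ m}) / M := by
      simp only [prob, Fintype.sum_prod_type, Finset.sum_div]
      refine Finset.sum_congr rfl fun m _ => Finset.sum_congr rfl fun y _ => ?_
      by_cases hy : d y = m <;> simp [E, p, hy]
    rw [← hp.2, ← prob_add_prob_compl p E, herr, add_sub_cancel_right]
  have hpq : relEntropy p r = (∑ m, relEntropy (K m) q) / M := by
    simp only [relEntropy, Fintype.sum_prod_type, p, r, div_div_div_cancel_right₀ hM.ne',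
      Finset.sum_div, div_mul_eq_mul_div]
  rw [hpE, ← hpq]
  exact prob_mul_logb_sub_one_le_relEntropy hp hr hpr hM hrE

end Fano

section RandomCoding

variable {U V μ : Type*} [Fintype U] {π : U → ℝ}

/-- The threshold test of random coding: the outputs for which the likelihood of the codeword `x`
exceeds `τ` times that of a random input with distribution `π`. -/
def accepted (π : U → ℝ) (K : U → V → ℝ) (τ : ℝ) (x : U) : Set V :=
  {y | τ * outputDist π K y < K x y}

lemma prob_setOf_mem_accepted_le (hπ : ∀ x, 0 ≤ π x) {K : U → V → ℝ} (hK : ∀ x y, 0 ≤ K x y)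
    {τ : ℝ} (hτ : 0 < τ) (y : V) : prob π {x | y ∈ accepted π K τ x} ≤ τ⁻¹ := by
  have hq : 0 ≤ outputDist π K y := Finset.sum_nonneg fun x _ => mul_nonneg (hπ x) (hK x y)
  rcases hq.eq_or_lt with h0 | h0
  · have hnull : prob π {x | y ∈ accepted π K τ x} ≤ prob π ∅ := by
      refine prob_mono hπ fun x hx hπx => ?_
      have hxy : 0 < K x y := by simpa [accepted, ← h0] using hx
      have hpos : 0 < π x * K x y := mul_pos ((hπ x).lt_of_ne' hπx) hxy
      exact absurd (mul_le_outputDist hπ hK x y) (by rw [← h0]; exact hpos.not_ge)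
    exact hnull.trans (by simp [prob, hτ.le])
  · have hmarkov : τ * outputDist π K y * prob π {x | y ∈ accepted π K τ x} ≤ outputDist π K y :=
      mul_prob_le_sum_mul hπ (fun x => hK x y) fun x hx => le_of_lt hx
    rw [← one_div, le_div_iff₀' hτ]
    refine le_of_mul_le_mul_right ?_ h0
    linarith

lemma prob_setOf_mem_iUnion_accepted_le {S : Type*} [Fintype S] (hπ : ∀ x, 0 ≤ π x)
    {K : S → U → V → ℝ} (hK : ∀ s x y, 0 ≤ K s x y) {τ : ℝ} (hτ : 0 < τ) (y : V) :
    prob π {x | y ∈ ⋃ s, accepted π (K s) τ x} ≤ Fintype.card S * τ⁻¹ := by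
  have hunion : {x | y ∈ ⋃ s, accepted π (K s) τ x} =
      ⋃ s ∈ (Finset.univ : Finset S), {x | y ∈ accepted π (K s) τ x} := by
    ext x
    simp
  rw [hunion, ← nsmul_eq_mul]
  exact (prob_biUnion_le hπ _ _).trans (Finset.sum_le_card_nsmul _ _ _ fun s _ =>
    prob_setOf_mem_accepted_le hπ (hK s) hτ y)

/-- The decoder that returns a message whose acceptance set contains the output. If there are
several it picks one of them, and if there is none it returns an arbitrary message. -/
noncomputable def setDecoder [Nonempty μ] (C : μ → Set V) (y : V) : μ :=
  Classical.epsilon fun m => y ∈ C m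

variable [Fintype V] [Fintype μ] [Nonempty μ]

lemma prob_setDecoder_ne_le [DecidableEq μ] {q : V → ℝ} (hq : ∀ y, 0 ≤ q y) (C : μ → Set V)
    (m : μ) :
    prob q {y | setDecoder C y ≠ m} ≤
      prob q (C m)ᶜ + ∑ m' ∈ Finset.univ.erase m, prob q (C m') := by
  calc prob q {y | setDecoder C y ≠ m}
      ≤ prob q ((C m)ᶜ ∪ ⋃ m' ∈ Finset.univ.erase m, C m') := by
        refine prob_mono hq fun y hy _ => ?_
        by_cases hm : y ∈ C m
        · have hdec : y ∈ C (setDecoder C y) :=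
            Classical.epsilon_spec (p := fun m => y ∈ C m) ⟨m, hm⟩
          exact Or.inr (Set.mem_biUnion (by simpa using hy) hdec)
        · exact Or.inl hm
    _ ≤ prob q (C m)ᶜ + ∑ m' ∈ Finset.univ.erase m, prob q (C m') :=
        (prob_union_le hq _ _).trans (by gcongr; exact prob_biUnion_le hq _ _)

lemma sum_prodDist_mul_prob_setDecoder_ne_le [DecidableEq μ] (hπ : π ∈ stdSimplex ℝ U)
    {K : U → V → ℝ} (hK : ∀ x, K x ∈ stdSimplex ℝ V) {C : U → Set V} {δ : ℝ}
    (hC : ∀ y, prob π {x | y ∈ C x} ≤ δ) (m : μ) :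
    ∑ e, prodDist (fun _ : μ => π) e *
        prob (K (e m)) {y | setDecoder (fun m => C (e m)) y ≠ m} ≤
      ∑ x, π x * prob (K x) (C x)ᶜ + (Fintype.card μ - 1) * δ := by
  have hpair (q : V → ℝ) (hq : q ∈ stdSimplex ℝ V) : ∑ x, π x * prob q (C x) ≤ δ := by
    rw [sum_mul_prob_comm]
    exact (convex_Iic δ).sum_mem (fun y _ => hq.1 y) hq.2 fun y _ => hC y
  have hother (m' : μ) (hm' : m' ∈ Finset.univ.erase m) :
      ∑ e, prodDist (fun _ : μ => π) e * prob (K (e m)) (C (e m')) ≤ δ := by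
    rw [sum_prodDist_mul_apply_apply (fun _ => hπ.2) (Finset.ne_of_mem_erase hm').symm
      fun x x' => prob (K x) (C x')]
    exact (convex_Iic δ).sum_mem (fun x _ => hπ.1 x) hπ.2 fun x _ => hpair (K x) (hK x)
  calc ∑ e, prodDist (fun _ : μ => π) e *
        prob (K (e m)) {y | setDecoder (fun m => C (e m)) y ≠ m}
      ≤ ∑ e, prodDist (fun _ : μ => π) e * (prob (K (e m)) (C (e m))ᶜ +
          ∑ m' ∈ Finset.univ.erase m, prob (K (e m)) (C (e m'))) :=
        Finset.sum_le_sum fun e _ => mul_le_mul_of_nonneg_left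
          (prob_setDecoder_ne_le (hK _).1 (fun m => C (e m)) m)
          ((prodDist_mem_stdSimplex fun _ => hπ).1 e)
    _ = ∑ x, π x * prob (K x) (C x)ᶜ + ∑ m' ∈ Finset.univ.erase m,
          ∑ e, prodDist (fun _ : μ => π) e * prob (K (e m)) (C (e m')) := by
        simp only [mul_add, Finset.sum_add_distrib, Finset.mul_sum]
        rw [sum_prodDist_mul_apply (fun _ => hπ.2) m fun x => prob (K x) (C x)ᶜ,
          Finset.sum_comm]
    _ ≤ ∑ x, π x * prob (K x) (C x)ᶜ + (Fintype.card μ - 1) * δ := by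
        gcongr
        refine (Finset.sum_le_card_nsmul _ _ _ hother).trans_eq ?_
        rw [nsmul_eq_mul, Finset.card_erase_of_mem (Finset.mem_univ m), Finset.card_univ,
          Nat.cast_pred Fintype.card_pos]

lemma exists_codebook_le {S : Type*} [Fintype S] (hπ : π ∈ stdSimplex ℝ U) {K : S → U → V → ℝ}
    (hK : ∀ s x, K s x ∈ stdSimplex ℝ V) {C : U → Set V} {δ : ℝ}
    (hC : ∀ y, prob π {x | y ∈ C x} ≤ δ) (g : S → U → ℝ) :
    ∃ e : μ → U, ∑ s, (∑ m, (prob (K s (e m)) {y | setDecoder (fun m => C (e m)) y ≠ m} +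
        g s (e m))) / Fintype.card μ ≤
      ∑ s, (∑ x, π x * (prob (K s x) (C x)ᶜ + g s x) + (Fintype.card μ - 1) * δ) := by
  classical
  have hM : (0 : ℝ) < Fintype.card μ := Nat.cast_pos.2 Fintype.card_pos
  refine exists_le_of_sum_mul_le (prodDist_mem_stdSimplex fun _ : μ => hπ) ?_
  simp only [Finset.mul_sum (s := (Finset.univ : Finset S)), mul_div_assoc', Finset.mul_sum]
  rw [Finset.sum_comm]
  refine Finset.sum_le_sum fun s _ => ?_
  rw [← Finset.sum_div, div_le_iff₀' hM, Finset.sum_comm, ← nsmul_eq_mul]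
  refine Finset.sum_le_card_nsmul _ _ _ fun m _ => ?_
  simp only [mul_add, Finset.sum_add_distrib]
  rw [sum_prodDist_mul_apply (fun _ => hπ.2) m (g s)]
  linarith [sum_prodDist_mul_prob_setDecoder_ne_le hπ (hK s) hC m]

end RandomCoding

/-! ### Laws induced by a code -/

section CodeLaws

variable {X Y Z S : Type*} [Fintype Y] {W : X × S → Y × Z → ℝ}

lemma inducedDist_eq_outputDist (W : X × S → Y × Z → ℝ) (s : S) {M n : ℕ} (c : Code X Y M n) :
    inducedDist W s c =
      outputDist (fun _ => 1 / (M : ℝ)) fun m => memoryless (margZ W s) (c.enc m) := by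
  ext z
  simp only [inducedDist, jointLaw, outputDist, memoryless, prodDist, margZ, Fintype.prod_sum,
    Finset.mul_sum]

variable [Fintype Z]

lemma margY_mem_stdSimplex (hW : ∀ a, W a ∈ stdSimplex ℝ (Y × Z)) (s : S) (a : X) :
    margY W s a ∈ stdSimplex ℝ Y :=
  ⟨fun b => Finset.sum_nonneg fun c _ => (hW (a, s)).1 (b, c),
    (Fintype.sum_prod_type _).symm.trans (hW (a, s)).2⟩

lemma margZ_mem_stdSimplex (hW : ∀ a, W a ∈ stdSimplex ℝ (Y × Z)) (s : S) (a : X) :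
    margZ W s a ∈ stdSimplex ℝ Z :=
  ⟨fun c => Finset.sum_nonneg fun b _ => (hW (a, s)).1 (b, c),
    (Fintype.sum_prod_type_right _).symm.trans (hW (a, s)).2⟩

lemma errorProb_eq (W : X × S → Y × Z → ℝ) (s : S) {M n : ℕ} (c : Code X Y M n) :
    errorProb W s c = (∑ m, prob (memoryless (margY W s) (c.enc m)) {y | c.dec y ≠ m}) / M := by
  simp only [errorProb, prob, Finset.sum_div]
  refine Finset.sum_congr rfl fun m _ => Finset.sum_congr rfl fun y _ => ?_
  by_cases hy : c.dec y = m
  · simp [hy]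
  · simp [hy, jointLaw, memoryless, prodDist, margY, Fintype.prod_sum, Finset.sum_div,
      inv_mul_eq_div]

lemma inducedDist_mem_stdSimplex (hW : ∀ a, W a ∈ stdSimplex ℝ (Y × Z)) (s : S) {M n : ℕ}
    [NeZero M] (c : Code X Y M n) : inducedDist W s c ∈ stdSimplex ℝ (Fin n → Z) := by
  rw [inducedDist_eq_outputDist]
  refine outputDist_mem_stdSimplex ⟨fun _ => by positivity, by simp⟩ fun m => ?_
  exact memoryless_mem_stdSimplex (margZ_mem_stdSimplex hW s) _

lemma errorProb_nonneg (hW : ∀ a, W a ∈ stdSimplex ℝ (Y × Z)) (s : S) {M n : ℕ}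
    (c : Code X Y M n) : 0 ≤ errorProb W s c := by
  rw [errorProb_eq]
  exact div_nonneg (Finset.sum_nonneg fun m _ => prob_nonneg
    (memoryless_mem_stdSimplex (margY_mem_stdSimplex hW s) _).1 _) (Nat.cast_nonneg M)

variable [DecidableEq Z]

lemma expectedDist_nonneg (hW : ∀ a, W a ∈ stdSimplex ℝ (Y × Z)) (Q : Z → ℝ) (s : S) {M n : ℕ}
    [NeZero M] (c : Code X Y M n) : 0 ≤ expectedDist W Q s c :=
  Finset.sum_nonneg fun z _ => mul_nonneg ((inducedDist_mem_stdSimplex hW s c).1 z)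
    (Finset.sum_nonneg fun _ _ => abs_nonneg _)

lemma expectedDist_eq (W : X × S → Y × Z → ℝ) (Q : Z → ℝ) (s : S) {M n : ℕ} (c : Code X Y M n) :
    expectedDist W Q s c =
      (∑ m, ∑ z, memoryless (margZ W s) (c.enc m) z * varDist Q (typeOf z)) / M := by
  simp only [expectedDist, inducedDist_eq_outputDist, sum_outputDist_mul, one_div_mul_eq_div,
    Finset.sum_div]

lemma expectedDist_le_varDist_add (hW : ∀ a, W a ∈ stdSimplex ℝ (Y × Z)) (P Q : Z → ℝ) (s : S)
    {M n : ℕ} [NeZero M] (c : Code X Y M n) :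
    expectedDist W Q s c ≤ varDist Q P + expectedDist W P s c := by
  have hP := inducedDist_mem_stdSimplex hW s c
  calc expectedDist W Q s c
      ≤ ∑ z, inducedDist W s c z * (varDist Q P + varDist P (typeOf z)) :=
        Finset.sum_le_sum fun z _ =>
          mul_le_mul_of_nonneg_left (varDist_triangle _ _ _) (hP.1 z)
    _ = varDist Q P + expectedDist W P s c := by
        simp only [mul_add, Finset.sum_add_distrib, ← Finset.sum_mul, hP.2, one_mul, expectedDist]

end CodeLaws

section FeasibleInputs

lemma margZ_mem_types {X Y Z S : Type*} [DecidableEq X] [Fintype Y] [DecidableEq Y] [Finite Z]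
    [DecidableEq Z] [DecidableEq S] {W : X × S → Y × Z → ℝ} (hW : W ∈ condTypes (X × S) (Y × Z))
    (s : S) (a : X) : margZ W s a ∈ types Z := by
  have := Fintype.ofFinite Z
  exact mem_types_iff.2 ⟨margZ_mem_stdSimplex (condTypes_mem_stdSimplex hW) s a,
    fun _ => sum_mem fun _ _ => condTypes_mem_fieldRange hW _ _⟩

variable {X Y Z S : Type*} [Fintype X] [DecidableEq X] [Fintype Y] [DecidableEq Y] [Fintype Z]
  [DecidableEq Z] {W : X × S → Y × Z → ℝ} {Q : Z → ℝ} {Δ : S → ℝ}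

lemma mem_feasibleInputs_iff [DecidableEq S] [Nonempty S] (hW : W ∈ condTypes (X × S) (Y × Z))
    {N : X → ℝ} :
    N ∈ feasibleInputs W Q Δ ↔
      N ∈ types X ∧ ∀ s, varDist Q (outputDist N (margZ W s)) ≤ Δ s := by
  simp only [feasibleInputs, deltaPreimage, neighborhood, Set.mem_iInter, Set.mem_ofPred_eq,
    forall_and, forall_const]
  exact and_congr_right fun hN =>
    and_iff_right fun s => outputDist_mem_types hN (margZ_mem_types hW s)

end FeasibleInputs

/-! ### Converse -/

section Converse

variable {X Y Z S : Type*}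

/-- The word of length `M * n` that lists the letters of all codewords of a code. Its type is the
average type of the codewords. -/
def allLetters {M n : ℕ} (c : Code X Y M n) (k : Fin (M * n)) : X :=
  c.enc (finProdFinEquiv.symm k).1 (finProdFinEquiv.symm k).2

variable [Fintype X] [DecidableEq X]

lemma sum_typeOf_allLetters_mul {M n : ℕ} (c : Code X Y M n) (f : X → ℝ) :
    ∑ a, typeOf (allLetters c) a * f a = (∑ m, (∑ i, f (c.enc m i)) / n) / M := by
  rw [sum_typeOf_mul, ← Finset.sum_div, div_div, mul_comm (n : ℝ), Nat.cast_mul,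
    ← Fintype.sum_prod_type' fun m i => f (c.enc m i)]
  exact congrArg (· / _) (finProdFinEquiv.symm.sum_comp fun w => f (c.enc w.1 w.2))

lemma outputDist_memoryless_typeOf {A B : Type*} [Fintype A] [DecidableEq A] [Fintype B]
    [DecidableEq B] {J : A → B → ℝ} (hJ : ∀ a, ∑ b, J a b = 1) {n : ℕ} (x : Fin n → A) :
    outputDist (memoryless J x) typeOf = outputDist (typeOf x) J := by
  ext b
  rw [outputDist, outputDist, sum_typeOf_mul]
  simp only [typeOf_eq_sum, mul_div_assoc', ← Finset.sum_div, Finset.mul_sum]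
  rw [Finset.sum_comm]
  refine congrArg (· / (n : ℝ)) (Finset.sum_congr rfl fun i _ => ?_)
  simpa [memoryless] using
    sum_prodDist_mul_apply (fun i => hJ (x i)) i fun a => if a = b then 1 else 0

variable [Fintype Y] [Fintype Z] {W : X × S → Y × Z → ℝ}

lemma outputDist_inducedDist_typeOf [DecidableEq Z] (hW : ∀ a, W a ∈ stdSimplex ℝ (Y × Z)) (s : S)
    {M n : ℕ} (c : Code X Y M n) :
    outputDist (inducedDist W s c) typeOf = outputDist (typeOf (allLetters c)) (margZ W s) := by
  ext b
  have hword (m : Fin M) : ∑ z, memoryless (margZ W s) (c.enc m) z * typeOf z b =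
      (∑ i, margZ W s (c.enc m i) b) / n :=
    (congrFun (outputDist_memoryless_typeOf (fun a => (margZ_mem_stdSimplex hW s a).2) _) b).trans
      (sum_typeOf_mul _ _)
  simp only [inducedDist_eq_outputDist, outputDist.eq_def (B := Z), sum_outputDist_mul, hword,
    sum_typeOf_allLetters_mul, one_div_mul_eq_div, ← Finset.sum_div]

lemma varDist_outputDist_allLetters_le [DecidableEq Z] (hW : ∀ a, W a ∈ stdSimplex ℝ (Y × Z))
    (Q : Z → ℝ) (s : S) {M n : ℕ} [NeZero M] (c : Code X Y M n) :
    varDist Q (outputDist (typeOf (allLetters c)) (margZ W s)) ≤ expectedDist W Q s c := by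
  rw [← outputDist_inducedDist_typeOf hW]
  exact varDist_outputDist_le (inducedDist_mem_stdSimplex hW s c) Q typeOf

lemma one_sub_errorProb_mul_logb_sub_one_le (hW : ∀ a, W a ∈ stdSimplex ℝ (Y × Z)) (s : S)
    {M n : ℕ} [NeZero M] [NeZero n] (c : Code X Y M n) :
    (1 - errorProb W s c) * Real.logb 2 M - 1 ≤
      n * mutualInfo (jointType (typeOf (allLetters c)) (margY W s)) := by
  have hJ := margY_mem_stdSimplex hW s
  set N := typeOf (allLetters c)
  have hN : N ∈ stdSimplex ℝ X := typeOf_mem_stdSimplex (NeZero.ne (M * n)) _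
  have hsupp (m : Fin M) (i : Fin n) :
      (margY W s (c.enc m i)).support ⊆ (outputDist N (margY W s)).support := by
    refine support_subset_support_outputDist hN.1 (fun a => (hJ a).1) ?_
    simpa [allLetters] using typeOf_apply_pos (allLetters c) (finProdFinEquiv (m, i))
  have hfano := fano_inequality (fun m => memoryless_mem_stdSimplex hJ (c.enc m))
    (prodDist_mem_stdSimplex fun _ => outputDist_mem_stdSimplex hN hJ)
    (fun m => support_prodDist_subset (hsupp m)) c.dec
  have hinfo (m : Fin M) : relEntropy (memoryless (margY W s) (c.enc m))
      (prodDist fun _ => outputDist N (margY W s)) =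
        ∑ i, relEntropy (margY W s (c.enc m i)) (outputDist N (margY W s)) :=
    relEntropy_prodDist (fun i => (hJ _).2) (hsupp m)
  rw [Fintype.card_fin, ← errorProb_eq] at hfano
  refine hfano.trans_eq ?_
  rw [mutualInfo_jointType N fun a => (hJ a).2, sum_typeOf_allLetters_mul]
  simp only [hinfo, ← Finset.sum_div]
  rw [mul_div_assoc', mul_div_cancel₀ _ (NeZero.ne (n : ℝ))]

end Converse

section RateBound

lemma numMessages_pos (R : ℝ) (n : ℕ) : 0 < numMessages R n := Nat.ceil_pos.2 (by positivity)

instance (R : ℝ) (n : ℕ) : NeZero (numMessages R n) := ⟨(numMessages_pos R n).ne'⟩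

lemma mul_le_logb_numMessages (R : ℝ) (n : ℕ) : n * R ≤ Real.logb 2 (numMessages R n) :=
  (Real.le_logb_iff_rpow_le one_lt_two (Nat.cast_pos.2 (numMessages_pos R n))).2 (Nat.le_ceil _)

variable {X Y Z S : Type*} [Fintype X] [Fintype Y] [Fintype Z]

/-- The information that an input of distribution `N` conveys through the compound channel `W` in
the worst channel state. -/
noncomputable def compoundInfo (W : X × S → Y × Z → ℝ) (N : X → ℝ) : ℝ :=
  ⨅ s, mutualInfo (jointType N (margY W s))

variable [DecidableEq X] [DecidableEq Z] {W : X × S → Y × Z → ℝ} {Q : Z → ℝ} {Δ : S → ℝ}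

lemma bddAbove_compoundInfo_image [Finite S] [Nonempty S]
    (hW : ∀ a, W a ∈ stdSimplex ℝ (Y × Z)) :
    BddAbove (compoundInfo W '' feasibleInputs W Q Δ) := by
  obtain ⟨s⟩ := ‹Nonempty S›
  refine ⟨Fintype.card X * (Real.log 2)⁻¹, Set.forall_mem_image.2 fun N hN => ?_⟩
  have hN' := (mem_types_iff.1 (Set.mem_iInter.1 hN s).1).1
  exact (ciInf_le (Set.finite_range _).bddBelow s).trans
    (mutualInfo_jointType_le hN'.1 (margY_mem_stdSimplex hW s))

variable [DecidableEq Y] [DecidableEq S] [Nonempty S]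

lemma typeOf_allLetters_mem_feasibleInputs (hW : W ∈ condTypes (X × S) (Y × Z)) {M n : ℕ}
    [NeZero M] [NeZero n] {c : Code X Y M n} (hc : ∀ s, expectedDist W Q s c ≤ Δ s) :
    typeOf (allLetters c) ∈ feasibleInputs W Q Δ :=
  (mem_feasibleInputs_iff hW).2 ⟨⟨_, NeZero.one_le, _, rfl⟩, fun s =>
    (varDist_outputDist_allLetters_le (condTypes_mem_stdSimplex hW) Q s c).trans (hc s)⟩

lemma Achievable.feasibleInputs_nonempty (hW : W ∈ condTypes (X × S) (Y × Z)) {R : ℝ}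
    (h : Achievable W Q R Δ) : (feasibleInputs W Q Δ).Nonempty := by
  obtain ⟨n₀, hn₀⟩ := h 1 one_pos
  obtain ⟨c, -, hc⟩ := hn₀ (n₀ + 1) n₀.lt_succ_self
  exact ⟨_, typeOf_allLetters_mem_feasibleInputs hW hc⟩

lemma one_sub_mul_sub_inv_le_sSup [Finite S] (hW : W ∈ condTypes (X × S) (Y × Z)) {R ε : ℝ}
    (hε : ε ≤ 1) {n : ℕ} [NeZero n] {c : Code X Y (numMessages R n) n}
    (herr : ∀ s, errorProb W s c ≤ ε) (hc : ∀ s, expectedDist W Q s c ≤ Δ s) :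
    (1 - ε) * R - (n : ℝ)⁻¹ ≤ sSup (compoundInfo W '' feasibleInputs W Q Δ) := by
  have hW' := condTypes_mem_stdSimplex hW
  have hn : (0 : ℝ) < n := Nat.cast_pos.2 (NeZero.pos n)
  have hlog : 0 ≤ Real.logb 2 (numMessages R n) :=
    Real.logb_nonneg one_lt_two (Nat.one_le_cast.2 (numMessages_pos R n))
  refine le_csSup_of_le (bddAbove_compoundInfo_image hW')
    (Set.mem_image_of_mem _ (typeOf_allLetters_mem_feasibleInputs hW hc)) (le_ciInf fun s => ?_)
  refine le_of_mul_le_mul_left ?_ hn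
  calc n * ((1 - ε) * R - (n : ℝ)⁻¹) = (1 - ε) * (n * R) - 1 := by field_simp
    _ ≤ (1 - ε) * Real.logb 2 (numMessages R n) - 1 := by
        gcongr
        exact mul_le_logb_numMessages R n
    _ ≤ (1 - errorProb W s c) * Real.logb 2 (numMessages R n) - 1 := by
        gcongr
        exact herr s
    _ ≤ n * mutualInfo (jointType (typeOf (allLetters c)) (margY W s)) :=
        one_sub_errorProb_mul_logb_sub_one_le hW' s c

lemma Achievable.le_sSup [Finite S] (hW : W ∈ condTypes (X × S) (Y × Z)) {R : ℝ}
    (h : Achievable W Q R Δ) : R ≤ sSup (compoundInfo W '' feasibleInputs W Q Δ) := by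
  have hrate {ε : ℝ} (hε : ε ∈ Set.Ioc 0 1) :
      (1 - ε) * R ≤ sSup (compoundInfo W '' feasibleInputs W Q Δ) := by
    obtain ⟨n₀, hn₀⟩ := h ε hε.1
    have hlim : Tendsto (fun n : ℕ => (1 - ε) * R - (n : ℝ)⁻¹) atTop (𝓝 ((1 - ε) * R)) := by
      simpa using tendsto_inv_atTop_nhds_zero_nat.const_sub ((1 - ε) * R)
    refine le_of_tendsto hlim ?_
    filter_upwards [eventually_gt_atTop n₀] with n hn
    have : NeZero n := ⟨(Nat.zero_le n₀).trans_lt hn |>.ne'⟩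
    obtain ⟨c, herr, hc⟩ := hn₀ n hn
    exact one_sub_mul_sub_inv_le_sSup hW hε.2 (fun s => (herr s).le) hc
  have hlim : Tendsto (fun ε : ℝ => (1 - ε) * R) (𝓝[>] 0) (𝓝 R) :=
    tendsto_nhdsWithin_of_tendsto_nhds (Continuous.tendsto' (by fun_prop) _ _ (by simp))
  refine le_of_tendsto hlim ?_
  filter_upwards [Ioc_mem_nhdsGT one_pos] with ε hε using hrate hε

end RateBound

/-! ### Achievability -/

section Achievability

lemma jointType_mem_stdSimplex {A B : Type*} [Fintype A] [Fintype B] {P : A → ℝ}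
    (hP : P ∈ stdSimplex ℝ A) {J : A → B → ℝ} (hJ : ∀ a, J a ∈ stdSimplex ℝ B) :
    jointType P J ∈ stdSimplex ℝ (A × B) :=
  ⟨fun w => mul_nonneg (hP.1 w.1) ((hJ w.1).1 w.2), by
    simp only [Fintype.sum_prod_type, jointType, ← Finset.mul_sum, (hJ _).2, mul_one, hP.2]⟩

lemma sum_logb_le_of_notMem_accepted {ι A B : Type*} [Fintype ι] [DecidableEq ι] [Fintype A]
    {P : A → ℝ} {J : A → B → ℝ} {γ : ℝ} {n : ℕ} {w : ι → A × B}
    (hJ : ∀ i, 0 < J (w i).1 (w i).2) (hq : ∀ i, 0 < outputDist P J (w i).2)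
    (hw : (fun i => (w i).2) ∉
      accepted (prodDist fun _ => P) (memoryless J) (2 ^ (γ * n)) fun i => (w i).1) :
    ∑ i, Real.logb 2 (J (w i).1 (w i).2 / outputDist P J (w i).2) ≤ γ * n := by
  have hratio (i : ι) := div_pos (hJ i) (hq i)
  rw [← Real.logb_prod _ _ fun i _ => (hratio i).ne',
    Real.logb_le_iff_le_rpow one_lt_two (Finset.prod_pos fun i _ => hratio i),
    Finset.prod_div_distrib, div_le_iff₀ (Finset.prod_pos fun i _ => hq i)]
  simpa only [accepted, outputDist_memoryless, memoryless, prodDist, Set.mem_ofPred_eq, not_lt]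
    using hw

lemma tendsto_sum_prodDist_mul_prob_compl_accepted {A B : Type*} [Fintype A] [Fintype B]
    {P : A → ℝ} (hP : P ∈ stdSimplex ℝ A) {J : A → B → ℝ} (hJ : ∀ a, J a ∈ stdSimplex ℝ B) {γ : ℝ}
    (hγ : γ < mutualInfo (jointType P J)) :
    Tendsto (fun n : ℕ => ∑ x, prodDist (fun _ : Fin n => P) x * prob (memoryless J x)
      (accepted (prodDist fun _ => P) (memoryless J) (2 ^ (γ * n)) x)ᶜ) atTop (𝓝 0) := by
  have hPJ := jointType_mem_stdSimplex hP hJ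
  have hmean : mutualInfo (jointType P J) =
      ∑ w, jointType P J w * Real.logb 2 (J w.1 w.2 / outputDist P J w.2) := by
    simp only [mutualInfo_jointType P fun a => (hJ a).2, relEntropy, Fintype.sum_prod_type,
      jointType, Finset.mul_sum, mul_assoc]
  rw [hmean] at hγ
  have hprod (n : ℕ) := (prodDist_mem_stdSimplex fun _ : Fin n => hPJ).1
  simp only [← prob_prodDist_jointType P J fun x =>
    (accepted (prodDist fun _ => P) (memoryless J) (2 ^ (γ * _)) x)ᶜ]
  refine squeeze_zero (fun n => prob_nonneg (hprod n) _) (fun n => ?_) (tendsto_prob_sum_le hPJ hγ)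
  refine prob_mono (hprod n) fun w hw hw0 => ?_
  have hne (i : Fin n) : P (w i).1 ≠ 0 ∧ J (w i).1 (w i).2 ≠ 0 :=
    mul_ne_zero_iff.1 (Finset.prod_ne_zero_iff.1 hw0 i (Finset.mem_univ i))
  have hPpos (i : Fin n) : 0 < P (w i).1 := (hP.1 _).lt_of_ne' (hne i).1
  have hJpos (i : Fin n) : 0 < J (w i).1 (w i).2 := ((hJ _).1 _).lt_of_ne' (hne i).2
  exact sum_logb_le_of_notMem_accepted hJpos
    (fun i => (mul_pos (hPpos i) (hJpos i)).trans_le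
      (mul_le_outputDist hP.1 (fun a => (hJ a).1) _ _)) hw

lemma numMessages_max_zero_sub_one_le (R : ℝ) (n : ℕ) :
    (numMessages (max 0 R) n : ℝ) - 1 ≤ 2 ^ (n * R) := by
  rcases le_total 0 R with hR | hR
  · rw [max_eq_right hR]
    exact sub_le_iff_le_add.2 (Nat.ceil_lt_add_one (by positivity)).le
  · simp only [max_eq_left hR, numMessages, mul_zero, Real.rpow_zero, Nat.ceil_one, Nat.cast_one,
      sub_self]
    positivity

lemma tendsto_numMessages_sub_one_mul {R γ : ℝ} (h : R < γ) :
    Tendsto (fun n : ℕ => ((numMessages (max 0 R) n : ℝ) - 1) * ((2 : ℝ) ^ (γ * n))⁻¹) atTop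
      (𝓝 0) := by
  have hgeom : Tendsto (fun n : ℕ => ((2 : ℝ) ^ (R - γ)) ^ n) atTop (𝓝 0) :=
    tendsto_pow_atTop_nhds_zero_of_lt_one (by positivity)
      (Real.rpow_lt_one_of_one_lt_of_neg one_lt_two (sub_neg.2 h))
  refine squeeze_zero (fun n => ?_) (fun n => ?_) hgeom
  · have hM : (1 : ℝ) ≤ numMessages (max 0 R) n := Nat.one_le_cast.2 (numMessages_pos _ n)
    exact mul_nonneg (sub_nonneg.2 hM) (by positivity)
  · calc ((numMessages (max 0 R) n : ℝ) - 1) * ((2 : ℝ) ^ (γ * n))⁻¹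
        ≤ 2 ^ (n * R) * ((2 : ℝ) ^ (γ * n))⁻¹ := by
          gcongr
          exact numMessages_max_zero_sub_one_le R n
      _ = ((2 : ℝ) ^ (R - γ)) ^ n := by
          rw [← Real.rpow_neg zero_le_two, ← Real.rpow_add two_pos, ← Real.rpow_mul_natCast
            zero_le_two]
          ring_nf

variable {X Y Z S : Type*} [Fintype X] [Fintype Y] [Fintype Z] [DecidableEq Z]
  {W : X × S → Y × Z → ℝ} {N : X → ℝ}

lemma exists_code_le [Fintype S] (hW : ∀ a, W a ∈ stdSimplex ℝ (Y × Z))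
    (hN : N ∈ stdSimplex ℝ X) {τ : ℝ} (hτ : 0 < τ) (M n : ℕ) [NeZero M] :
    ∃ c : Code X Y M n,
      ∑ s, (errorProb W s c + expectedDist W (outputDist N (margZ W s)) s c) ≤
        ∑ s, (∑ x, prodDist (fun _ : Fin n => N) x * prob (memoryless (margY W s) x)
            (accepted (prodDist fun _ => N) (memoryless (margY W s)) τ x)ᶜ +
          ∑ z, prodDist (fun _ : Fin n => outputDist N (margZ W s)) z *
            varDist (outputDist N (margZ W s)) (typeOf z) +
          (M - 1) * (Fintype.card S * τ⁻¹)) := by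
  have hπ := prodDist_mem_stdSimplex fun _ : Fin n => hN
  have hK (s : S) (x : Fin n → X) := memoryless_mem_stdSimplex (margY_mem_stdSimplex hW s) x
  obtain ⟨e, he⟩ := exists_codebook_le (μ := Fin M) hπ hK
    (prob_setOf_mem_iUnion_accepted_le hπ.1 (fun s x => (hK s x).1) hτ)
    fun s x => ∑ z, memoryless (margZ W s) x z * varDist (outputDist N (margZ W s)) (typeOf z)
  refine ⟨⟨e, setDecoder fun m =>
    ⋃ s, accepted (prodDist fun _ => N) (memoryless (margY W s)) τ (e m)⟩, ?_⟩
  simp only [errorProb_eq, expectedDist_eq, ← add_div, ← Finset.sum_add_distrib]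
  rw [Fintype.card_fin] at he
  refine he.trans (Finset.sum_le_sum fun s _ => ?_)
  simp only [mul_add, Finset.sum_add_distrib]
  rw [← sum_outputDist_mul, outputDist_memoryless]
  gcongr with x
  · exact hπ.1 x
  · exact prob_mono (hK s x).1 fun y hy _ => fun hy' => hy (Set.mem_iUnion_of_mem s hy')

lemma exists_code_tendsto_zero [Fintype S] (hW : ∀ a, W a ∈ stdSimplex ℝ (Y × Z))
    (hN : N ∈ stdSimplex ℝ X) {R : ℝ} (hR : R < compoundInfo W N) :
    ∃ c : ∀ n, Code X Y (numMessages (max 0 R) n) n, Tendsto (fun n =>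
      ∑ s, (errorProb W s (c n) + expectedDist W (outputDist N (margZ W s)) s (c n))) atTop
        (𝓝 0) := by
  obtain ⟨γ, hRγ, hγ⟩ := exists_between hR
  choose c hc using fun n : ℕ => exists_code_le hW hN (τ := 2 ^ (γ * n)) (by positivity)
    (numMessages (max 0 R) n) n
  refine ⟨c, squeeze_zero (fun n => ?_) hc ?_⟩
  · exact Finset.sum_nonneg fun s _ =>
      add_nonneg (errorProb_nonneg hW s _) (expectedDist_nonneg hW _ s _)
  · have hzero : ∑ _s : S, (0 : ℝ) = 0 := Finset.sum_const_zero
    refine hzero ▸ tendsto_finsetSum _ fun s _ => ?_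
    have hmiss := tendsto_sum_prodDist_mul_prob_compl_accepted hN (margY_mem_stdSimplex hW s)
      (hγ.trans_le (ciInf_le (Set.finite_range _).bddBelow s))
    have hdist := tendsto_sum_prodDist_mul_varDist_typeOf
      (outputDist_mem_stdSimplex hN (margZ_mem_stdSimplex hW s))
    have hconfusion := (tendsto_numMessages_sub_one_mul hRγ).const_mul (Fintype.card S : ℝ)
    simpa [mul_left_comm] using (hmiss.add hdist).add hconfusion

lemma achievable_max_zero_of_lt_compoundInfo [DecidableEq X] [DecidableEq Y] [Finite S]
    [DecidableEq S] [Nonempty S] (hW : W ∈ condTypes (X × S) (Y × Z)) {Q : Z → ℝ} {Δ : S → ℝ}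
    (hN : N ∈ feasibleInputs W Q Δ) {R δ : ℝ} (hR : R < compoundInfo W N) (hδ : 0 < δ) :
    Achievable W Q (max 0 R) fun s => Δ s + δ := by
  have := Fintype.ofFinite S
  have hW' := condTypes_mem_stdSimplex hW
  obtain ⟨hN, hNΔ⟩ := (mem_feasibleInputs_iff hW).1 hN
  obtain ⟨c, hc⟩ := exists_code_tendsto_zero hW' (mem_types_iff.1 hN).1 hR
  intro ε hε
  obtain ⟨n₀, hn₀⟩ := eventually_atTop.1 (hc.eventually_lt_const (lt_min hε hδ))
  refine ⟨n₀, fun n hn => ⟨c n, forall_and.1 fun s => ?_⟩⟩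
  set P := outputDist N (margZ W s)
  have hE := errorProb_nonneg hW' s (c n)
  have hD := expectedDist_nonneg hW' P s (c n)
  have hsum : errorProb W s (c n) + expectedDist W P s (c n) < min ε δ :=
    (Finset.single_le_sum (f := fun s => errorProb W s (c n) +
      expectedDist W (outputDist N (margZ W s)) s (c n)) (fun s _ =>
      add_nonneg (errorProb_nonneg hW' s _) (expectedDist_nonneg hW' _ s _))
      (Finset.mem_univ s)).trans_lt (hn₀ n hn.le)
  obtain ⟨hsumε, hsumδ⟩ := lt_min_iff.1 hsum
  refine ⟨by linarith, (expectedDist_le_varDist_add hW' P Q s (c n)).trans ?_⟩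
  linarith [hNΔ s]

lemma mem_capacityRegion_of_le_sSup [DecidableEq X] [DecidableEq Y] [Finite S] [DecidableEq S]
    [Nonempty S] (hW : W ∈ condTypes (X × S) (Y × Z)) {Q : Z → ℝ} {Δ : S → ℝ}
    (hne : (feasibleInputs W Q Δ).Nonempty) {R : ℝ} (hR : 0 ≤ R)
    (h : R ≤ sSup (compoundInfo W '' feasibleInputs W Q Δ)) : (R, Δ) ∈ capacityRegion W Q := by
  have hlim : Tendsto (fun δ : ℝ => (max 0 (R - δ), fun s => Δ s + δ)) (𝓝[>] 0) (𝓝 (R, Δ)) :=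
    tendsto_nhdsWithin_of_tendsto_nhds (Continuous.tendsto' (by fun_prop) _ _ (by simp [hR]))
  refine mem_closure_of_tendsto hlim ?_
  filter_upwards [self_mem_nhdsWithin] with δ hδ
  obtain ⟨_, ⟨N, hN, rfl⟩, hRN⟩ :=
    exists_lt_of_lt_csSup (hne.image _) ((sub_lt_self R hδ).trans_le h)
  exact ⟨le_max_left _ _, achievable_max_zero_of_lt_compoundInfo hW hN hRN hδ⟩

end Achievability

end InterferenceCoordination

theorem theorem3_general {X Y Z S : Type*}
    [Fintype X] [DecidableEq X] [Fintype Y] [DecidableEq Y] [Fintype Z] [DecidableEq Z]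
    [Finite S] [DecidableEq S] [Nonempty S]
    (W : X × S → Y × Z → ℝ) (hW : W ∈ condTypes (X × S) (Y × Z)) (Q : Z → ℝ) :
    capacityRegion W Q =
      closure {t : ℝ × (S → ℝ) | (feasibleInputs W Q t.2).Nonempty ∧ 0 ≤ t.1 ∧
        t.1 ≤ sSup ((fun N : X → ℝ => ⨅ s, mutualInfo (jointType N (margY W s))) ''
          feasibleInputs W Q t.2)} := by
  refine (closure_mono fun t ht => ?_).antisymm (closure_minimal (fun t ht => ?_) isClosed_closure)
  · exact ⟨ht.2.feasibleInputs_nonempty hW, ht.1, ht.2.le_sSup hW⟩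
  · exact mem_capacityRegion_of_le_sSup hW ht.1 ht.2.1 ht.2.2

theorem theorem3 {X Y Z S : Type*}
    [Fintype X] [DecidableEq X] [Fintype Y] [DecidableEq Y] [Fintype Z] [DecidableEq Z]
    [Fintype S] [DecidableEq S] [Nonempty S]
    (W : X × S → Y × Z → ℝ) (hW : W ∈ condTypes (X × S) (Y × Z))
    (Q : Z → ℝ) (hQ : Q ∈ types Z) :
    capacityRegion W Q =
      closure {t : ℝ × (S → ℝ) | (feasibleInputs W Q t.2).Nonempty ∧ 0 ≤ t.1 ∧
        t.1 ≤ sSup ((fun N : X → ℝ => ⨅ s, mutualInfo (jointType N (margY W s))) ''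
          feasibleInputs W Q t.2)} :=
  theorem3_general W hW Q
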